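/- For a finite group $G$ let $i(G)=|\{x\in G : x^2=1\}|$ (the identity is counted) and let $c(G)$ be the number of cyclic subgroups of $G$ (the trivial subgroup is counted). Let $\mathbb{Z}_n$ denote the cyclic group of order $n$ and $D_{2n}$ the dihedral group of order $2n$. Let $G$ be a finite group and write $i(G)=c(G)-r$ with $r$ an integer. Then: (1) $r=0$ if and only if $G\cong\mathbb{Z}_2^n$ for some integer $n\ge 0$. (2) $r=1$ if and only if $G$ is isomorphic to $\mathbb{Z}_4$, to $D_8$, or, for some odd prime $p$, to $\mathbb{Z}_p$ or $D_{2p}$. (3) $r=2$ if and only if $G$ is isomorphic to $\mathbb{Z}_2\times\mathbb{Z}_4$, $\mathbb{Z}_2\times D_8$, $\mathbb{Z}_8$, $D_{16}$, or, for some odd prime $p$, to $\mathbb{Z}_{p^2}$, $D_{2p^2}$, $\mathbb{Z}_{2p}$ or $D_{4p}$. -/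

import Mathlib

/-- `I(G)`: the set of elements `x` of `G` with `x ^ 2 = 1` (the identity is included). -/
def involutionSet (G : Type*) [Group G] : Set G := {x | x ^ 2 = 1}

/-- `C(G)`: the set of cyclic subgroups of `G` (the trivial subgroup is included). -/
def cyclicSubgroupSet (G : Type*) [Group G] : Set (Subgroup G) := {H | IsCyclic H}

/-- `i(G) = |I(G)|`. -/
noncomputable def numInvolutions (G : Type*) [Group G] : ℕ := (involutionSet G).ncard

/-- `c(G) = |C(G)|`. -/
noncomputable def numCyclicSubgroups (G : Type*) [Group G] : ℕ := (cyclicSubgroupSet G).ncard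

/-- `Cyc n`: the cyclic group of order `n` (for `n ≥ 1`), written multiplicatively. -/
abbrev Cyc (n : ℕ) : Type := Multiplicative (ZMod n)

/-- `Dih n`: the dihedral group of order `2 * n` (for `n ≥ 1`); so the dihedral group of
order 8 is `Dih 4`. -/
abbrev Dih (n : ℕ) : Type := DihedralGroup n

open Subgroup

/-! A cyclic subgroup of order at most two has a unique generator, and that generator squares to
one. Hence r is exactly the number of large cyclic subgroups, those of order at least three, and the
theorem classifies groups with zero, one or two of them.

With none, `G` is a vector space over the field of two elements. If all of them lie inside one ⟨a⟩,
every element outside ⟨a⟩ squares to one. By `surjective_or_exists_inverting`, either `G` = ⟨a⟩ or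
⟨a⟩ has index two and is inverted from outside, so `G` is cyclic or dihedral. Then r counts the
divisors of the order of a that exceed two, and setting this to one or two gives the families.

The remaining case is two incomparable subgroups ⟨a⟩ and ⟨b⟩. By
`sq_eq_sq_and_commute_of_incomparable`, a and b commute, have order four and share their square, so
ab is an involution outside ⟨a⟩. The same dichotomy applied to ⟨ab⟩ × ⟨a⟩ leaves Z₂ × Z₄ and Z₂ ×
D₈. -/

/-- The cyclic subgroups of `G` of order at least three. -/
def largeCyclic (G : Type*) [Group G] : Set (Subgroup G) := zpowers '' {g | g ^ 2 ≠ 1}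

/-! ### Cyclic subgroups counted by order -/

section Counting

variable {G : Type*} [Group G]

theorem sq_eq_one_of_mem_zpowers {g h : G} (hg : g ^ 2 = 1) (hh : h ∈ zpowers g) :
    h ^ 2 = 1 := by
  obtain ⟨k, rfl⟩ := mem_zpowers_iff.1 hh
  rw [← zpow_natCast, zpow_comm, zpow_natCast, hg, one_zpow]

theorem eq_one_or_eq_of_mem_zpowers {g h : G} (hg : g ^ 2 = 1) (hh : h ∈ zpowers g) :
    h = 1 ∨ h = g := by
  obtain ⟨k, rfl⟩ := mem_zpowers_iff.1 hh
  have hg' : g ^ (2 : ℤ) = 1 := by exact_mod_cast hg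
  obtain ⟨m, rfl | rfl⟩ := Int.even_or_odd' k
  · left; rw [zpow_mul, hg', one_zpow]
  · right; rw [zpow_add, zpow_mul, hg', one_zpow, one_mul, zpow_one]

theorem zpowers_injOn_involutionSet : Set.InjOn zpowers (involutionSet G) := by
  intro x hx y hy hxy
  have h1 : x ∈ zpowers y := hxy ▸ mem_zpowers x
  have h2 : y ∈ zpowers x := hxy ▸ mem_zpowers y
  rcases eq_one_or_eq_of_mem_zpowers hy h1 with h | h
  · rcases eq_one_or_eq_of_mem_zpowers hx h2 with h' | h'
    · rw [h, h']
    · exact h'.symm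
  · exact h

theorem cyclicSubgroupSet_eq :
    cyclicSubgroupSet G = zpowers '' involutionSet G ∪ largeCyclic G := by
  ext H
  constructor
  · intro h
    obtain ⟨g, rfl⟩ := (Subgroup.isCyclic_iff_exists_zpowers_eq_top H).1 h
    by_cases hg : g ^ 2 = 1
    · exact Or.inl ⟨g, hg, rfl⟩
    · exact Or.inr ⟨g, hg, rfl⟩
  · rintro (⟨g, -, rfl⟩ | ⟨g, -, rfl⟩) <;>
    exact (inferInstance : IsCyclic (zpowers g))

theorem numCyclicSubgroups_eq [Finite G] :
    numCyclicSubgroups G = numInvolutions G + (largeCyclic G).ncard := by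
  rw [numCyclicSubgroups, cyclicSubgroupSet_eq, Set.ncard_union_eq, numInvolutions,
    zpowers_injOn_involutionSet.ncard_image]
  · rw [Set.disjoint_left]
    rintro _ ⟨g, hg, rfl⟩ ⟨h, hh, hgh⟩
    exact hh (sq_eq_one_of_mem_zpowers hg (hgh ▸ mem_zpowers h))

theorem zpowers_pow_eq_zpowers_pow_gcd [Finite G] (a : G) (k : ℕ) :
    zpowers (a ^ k) = zpowers (a ^ (orderOf a).gcd k) := by
  refine Subgroup.eq_of_le_of_card_ge ?_ ?_
  · obtain ⟨m, hm⟩ := Nat.gcd_dvd_right (orderOf a) k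
    have h : a ^ k = (a ^ (orderOf a).gcd k) ^ m := by rw [← pow_mul, ← hm]
    rw [zpowers_le, h]
    exact pow_mem (mem_zpowers _) m
  · rw [Nat.card_zpowers, Nat.card_zpowers, orderOf_pow, orderOf_pow, Nat.gcd_gcd_self_right_left]

/-- Every large cyclic subgroup lies in ⟨a⟩, which has exactly one subgroup of each order d dividing
`orderOf a`, generated by `a ^ (orderOf a / d)`. -/
theorem largeCyclic_ncard_of_forall_notMem [Finite G] (a : G)
    (h : ∀ g ∉ zpowers a, g ^ 2 = 1) :
    (largeCyclic G).ncard = ((orderOf a).divisors.filter (2 < ·)).card := by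
  have hn : 0 < orderOf a := orderOf_pos a
  have ho : ∀ d ∈ (orderOf a).divisors, orderOf (a ^ (orderOf a / d)) = d := fun d hd ↦ by
    have hd' := Nat.dvd_of_mem_divisors hd
    rw [orderOf_pow, Nat.gcd_eq_right (Nat.div_dvd_of_dvd hd'), Nat.div_div_self hd' hn.ne']
  have himg : largeCyclic G = (fun d ↦ zpowers (a ^ (orderOf a / d))) ''
      ((orderOf a).divisors.filter (2 < ·) : Finset ℕ) := by
    ext H
    constructor
    · rintro ⟨g, hg, rfl⟩
      have hga : g ∈ zpowers a := by
        by_contra hc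
        exact hg (h g hc)
      obtain ⟨k, rfl⟩ := (mem_powers_iff_mem_zpowers.2 hga)
      have hdvd : orderOf (a ^ k) ∣ orderOf a := orderOf_pow_dvd k
      refine ⟨orderOf (a ^ k), ?_, ?_⟩
      · simp only [Finset.coe_filter, Nat.mem_divisors, Set.mem_ofPred_eq]
        refine ⟨⟨hdvd, hn.ne'⟩, ?_⟩
        by_contra hc
        have hpos : 0 < orderOf (a ^ k) := orderOf_pos _
        apply hg
        have : orderOf (a ^ k) ∣ 2 := by
          generalize orderOf (a ^ k) = m at *
          interval_cases m <;> decide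
        exact orderOf_dvd_iff_pow_eq_one.1 this
      · simp only
        rw [zpowers_pow_eq_zpowers_pow_gcd a k, orderOf_pow,
          Nat.div_div_self (Nat.gcd_dvd_left _ _) hn.ne']
    · rintro ⟨d, hd, rfl⟩
      simp only [Finset.coe_filter, Set.mem_ofPred_eq] at hd
      refine ⟨_, fun hc ↦ ?_, rfl⟩
      have := Nat.le_of_dvd two_pos (orderOf_dvd_iff_pow_eq_one.2 hc)
      rw [ho d hd.1] at this
      omega
  rw [himg, Set.InjOn.ncard_image, Set.ncard_coe_finset]
  intro d hd e he hde
  simp only [Finset.coe_filter, Set.mem_ofPred_eq] at hd he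
  have := congrArg (fun H : Subgroup G ↦ Nat.card H) hde
  simpa only [Nat.card_zpowers, ho d hd.1, ho e he.1] using this

end Counting

/-! ### Integers with one or two divisors above two -/

section Divisors

theorem filter_two_lt_divisors_prime {p : ℕ} (hp : p.Prime) (hodd : Odd p) :
    p.divisors.filter (2 < ·) = {p} := by
  have h2 := hp.two_le
  have : p ≠ 2 := by rintro rfl; exact absurd hodd (by decide)
  ext d
  simp only [Finset.mem_filter, Nat.mem_divisors, Finset.mem_singleton, Nat.dvd_prime hp]
  omega

theorem filter_two_lt_divisors_prime_sq {p : ℕ} (hp : p.Prime) (hodd : Odd p) :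
    (p ^ 2).divisors.filter (2 < ·) = {p, p ^ 2} := by
  have h2 := hp.two_le
  have : p ≠ 2 := by rintro rfl; exact absurd hodd (by decide)
  have : 2 < p ^ 2 := by nlinarith
  ext d
  simp only [Finset.mem_filter, Nat.mem_divisors, Finset.mem_insert, Finset.mem_singleton,
    Nat.dvd_prime_pow hp]
  constructor
  · rintro ⟨⟨⟨k, hk, rfl⟩, -⟩, hd⟩
    interval_cases k <;> simp_all
  · rintro (rfl | rfl)
    · exact ⟨⟨⟨1, by simp⟩, by positivity⟩, by omega⟩
    · exact ⟨⟨⟨2, by simp⟩, by positivity⟩, by omega⟩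

theorem filter_two_lt_divisors_two_mul_prime {p : ℕ} (hp : p.Prime) (hodd : Odd p) :
    (2 * p).divisors.filter (2 < ·) = {p, 2 * p} := by
  have h2 := hp.two_le
  have : p ≠ 2 := by rintro rfl; exact absurd hodd (by decide)
  ext d
  simp only [Finset.mem_filter, Nat.mem_divisors, Finset.mem_insert, Finset.mem_singleton]
  constructor
  · rintro ⟨⟨hd, -⟩, hd2⟩
    obtain ⟨x, y, hx, hy, rfl⟩ := exists_dvd_and_dvd_of_dvd_mul hd
    rcases (Nat.dvd_prime Nat.prime_two).1 hx with rfl | rfl <;>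
    rcases (Nat.dvd_prime hp).1 hy with rfl | rfl <;> simp_all
  · rintro (rfl | rfl)
    · exact ⟨⟨dvd_mul_left _ _, by omega⟩, by omega⟩
    · exact ⟨⟨dvd_rfl, by omega⟩, by omega⟩

theorem card_filter_two_lt_divisors_eq_one {n : ℕ} :
    (n.divisors.filter (2 < ·)).card = 1 ↔ n = 4 ∨ n.Prime ∧ Odd n := by
  constructor
  · intro h
    obtain ⟨m, hm⟩ := Finset.card_eq_one.1 h
    have hmem : ∀ d, d ∣ n → 2 < d → d = m := fun d hd h2 ↦ by
      have hn : n ≠ 0 := by rintro rfl; simp at h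
      have : d ∈ n.divisors.filter (2 < ·) := by simp [hd, hn, h2]
      simpa [hm] using this
    have hm' : m ∈ n.divisors.filter (2 < ·) := by simp [hm]
    simp only [Finset.mem_filter, Nat.mem_divisors] at hm'
    have hn2 : 2 < n := hm'.2.trans_le (Nat.le_of_dvd (Nat.pos_of_ne_zero hm'.1.2) hm'.1.1)
    have hn := hmem n dvd_rfl hn2
    rcases n.eq_two_pow_or_exists_odd_prime_and_dvd with ⟨k, hk⟩ | ⟨p, hp, hpn, hodd⟩
    · left
      have hk2 : 2 ≤ k := by
        by_contra hc
        have : k ≤ 1 := by omega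
        interval_cases k <;> omega
      have h4 : 4 ∣ n := hk ▸ pow_dvd_pow 2 hk2
      rw [hn, ← hmem 4 h4 (by norm_num)]
    · right
      have : 2 < p := lt_of_le_of_ne hp.two_le (by rintro rfl; exact absurd hodd (by decide))
      rw [hn, ← hmem p hpn this]
      exact ⟨hp, hodd⟩
  · rintro (rfl | ⟨hp, hodd⟩)
    · decide
    · rw [filter_two_lt_divisors_prime hp hodd, Finset.card_singleton]

theorem card_filter_two_lt_divisors_eq_two {n : ℕ} :
    (n.divisors.filter (2 < ·)).card = 2 ↔
      n = 8 ∨ ∃ p : ℕ, p.Prime ∧ Odd p ∧ (n = p ^ 2 ∨ n = 2 * p) := by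
  constructor
  · intro h
    have hn : n ≠ 0 := by rintro rfl; simp at h
    have hmem : ∀ {x y z : ℕ}, x ∣ n → y ∣ n → z ∣ n → 2 < x → 2 < y → 2 < z → x ≠ y → x ≠ z →
        y ≠ z → False := fun {x y z} hx hy hz hx2 hy2 hz2 hxy hxz hyz ↦ by
      have hsub : ({x, y, z} : Finset ℕ) ⊆ n.divisors.filter (2 < ·) := by
        intro d hd
        simp only [Finset.mem_insert, Finset.mem_singleton] at hd
        rcases hd with rfl | rfl | rfl <;> simp [*]
      have := Finset.card_le_card hsub
      rw [h, Finset.card_eq_three.2 ⟨x, y, z, hxy, hxz, hyz, rfl⟩] at this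
      omega
    rcases n.eq_two_pow_or_exists_odd_prime_and_dvd with ⟨k, hk⟩ | ⟨p, hp, hpn, hodd⟩
    · left
      by_cases hk3 : k ≤ 3
      · interval_cases k <;> subst hk
        · exact absurd h (by decide)
        · exact absurd h (by decide)
        · exact absurd h (by decide)
        · rfl
      · push Not at hk3
        have hdvd : ∀ {j}, j ≤ k → 2 ^ j ∣ n := fun hj ↦ by rw [hk]; exact pow_dvd_pow 2 hj
        -- From exponent four on, 4, 8 and 16 are already three divisors above two.
        exact (hmem (x := 2 ^ 2) (y := 2 ^ 3) (z := 2 ^ 4) (hdvd (by omega)) (hdvd (by omega))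
          (hdvd (by omega))
          (by norm_num) (by norm_num) (by norm_num) (by norm_num) (by norm_num)
          (by norm_num)).elim
    · right
      refine ⟨p, hp, hodd, ?_⟩
      have hp2 : 2 < p := lt_of_le_of_ne hp.two_le (by rintro rfl; exact absurd hodd (by decide))
      obtain ⟨q, rfl⟩ := hpn
      have hq0 : 0 < q := Nat.pos_of_ne_zero (by rintro rfl; simp at hn)
      have hq1 : q ≠ 1 := by
        rintro rfl
        rw [mul_one, filter_two_lt_divisors_prime hp hodd] at h
        simp at h
      by_cases hq2 : q = 2
      · right; rw [hq2, mul_comm]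
      by_cases hqp : q = p
      · left; rw [hqp, sq]
      -- A cofactor q other than 1, 2 and p makes p, q and pq three distinct divisors above two.
      exact (hmem (x := p) (y := q) (z := p * q) (dvd_mul_right _ _) (dvd_mul_left _ _) dvd_rfl
        hp2 (by omega) (by nlinarith) (Ne.symm hqp) (by nlinarith [show 2 ≤ q by omega])
        (by nlinarith)).elim
  · rintro (rfl | ⟨p, hp, hodd, rfl | rfl⟩)
    · decide
    · rw [filter_two_lt_divisors_prime_sq hp hodd, Finset.card_pair]
      have := hp.two_le
      nlinarith
    · rw [filter_two_lt_divisors_two_mul_prime hp hodd, Finset.card_pair]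
      have := hp.two_le
      omega

end Divisors

/-! ### Homomorphisms out of cyclic and dihedral groups -/

section Lifts

variable {G : Type*} [Group G]

/-- The homomorphism from the cyclic group of order `n` sending the generator to `g`. -/
def cycLift {n : ℕ} (g : G) (hg : g ^ n = 1) : Cyc n →* G :=
  AddMonoidHom.toMultiplicativeLeft
    (ZMod.lift n ⟨zmultiplesHom (Additive G) (Additive.ofMul g), by
      simpa [← ofMul_pow] using hg⟩)

theorem cycLift_intCast {n : ℕ} (g : G) (hg : g ^ n = 1) (k : ℤ) :
    cycLift g hg (Multiplicative.ofAdd (k : ZMod n)) = g ^ k := by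
  have h : (zmultiplesHom (Additive G) (Additive.ofMul g)) n = 0 := by
    simpa [← ofMul_pow] using hg
  exact ZMod.lift_coe n ⟨zmultiplesHom (Additive G) (Additive.ofMul g), h⟩ k

theorem exists_eq_intCast {n : ℕ} (z : Cyc n) :
    ∃ k : ℤ, z = Multiplicative.ofAdd (k : ZMod n) := by
  obtain ⟨k, hk⟩ := ZMod.intCast_surjective z.toAdd
  exact ⟨k, by rw [hk]; rfl⟩

theorem cycLift_injective {n : ℕ} (g : G) (hg : orderOf g = n) :
    Function.Injective (cycLift g (orderOf_dvd_iff_pow_eq_one.1 hg.dvd)) := by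
  rw [injective_iff_map_eq_one]
  intro z hz
  obtain ⟨k, rfl⟩ := exists_eq_intCast z
  rw [cycLift_intCast, ← orderOf_dvd_iff_zpow_eq_one, hg] at hz
  rw [(ZMod.intCast_zmod_eq_zero_iff_dvd k n).2 hz]
  rfl

theorem cycLift_range {n : ℕ} (g : G) (hg : g ^ n = 1) : (cycLift g hg).range = zpowers g := by
  ext y
  constructor
  · rintro ⟨z, rfl⟩
    obtain ⟨k, rfl⟩ := exists_eq_intCast z
    rw [cycLift_intCast]
    exact zpow_mem (mem_zpowers g) k
  · rintro ⟨k, rfl⟩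
    exact ⟨_, cycLift_intCast g hg k⟩

/-- The homomorphism from a dihedral group determined by its values `φ` on the rotations and `x`
on the reflection `sr 0`. -/
def dihLift {n : ℕ} (φ : Cyc n →* G) (x : G) (hx : x * x = 1)
    (hφ : ∀ z, φ z * x = x * (φ z)⁻¹) : Dih n →* G :=
  MonoidHom.mk' (fun
      | .r i => φ (Multiplicative.ofAdd i)
      | .sr i => x * φ (Multiplicative.ofAdd i)) <| by
    rintro (i | i) (j | j)
    · simp
    · simp only [DihedralGroup.r_mul_sr, ofAdd_sub, map_div]
      rw [← mul_assoc, hφ, mul_assoc, ← map_inv, ← map_mul, ← map_div, mul_comm, div_eq_mul_inv]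
    · simp [mul_assoc]
    · simp only [DihedralGroup.sr_mul_sr, ofAdd_sub, map_div]
      rw [mul_assoc, ← mul_assoc (φ _), hφ, mul_assoc, ← mul_assoc, hx, one_mul, ← map_inv,
        ← map_mul, ← map_div, mul_comm, div_eq_mul_inv]

theorem dihLift_r {n : ℕ} (φ : Cyc n →* G) (x : G) (hx : x * x = 1)
    (hφ : ∀ z, φ z * x = x * (φ z)⁻¹) (i : ZMod n) :
    dihLift φ x hx hφ (.r i) = φ (Multiplicative.ofAdd i) := rfl

theorem dihLift_sr {n : ℕ} (φ : Cyc n →* G) (x : G) (hx : x * x = 1)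
    (hφ : ∀ z, φ z * x = x * (φ z)⁻¹) (i : ZMod n) :
    dihLift φ x hx hφ (.sr i) = x * φ (Multiplicative.ofAdd i) := rfl

end Lifts

/-! ### Groups whose elements outside an abelian subgroup are involutions -/

section Inversion

variable {G : Type*} [Group G]

/-- If every element outside a commutative subgroup `N` squares to one, and `N` is not of exponent
two, then `N` is everything or has index two and is inverted by every outer element. -/
theorem surjective_or_exists_inverting {N : Type*} [CommGroup N] (φ : N →* G)
    (hN : ∃ z, φ z ^ 2 ≠ 1) (h : ∀ g ∉ φ.range, g ^ 2 = 1) :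
    Function.Surjective φ ∨ ∃ x ∉ φ.range, x * x = 1 ∧ (∀ z, φ z * x = x * (φ z)⁻¹) ∧
      ∀ g ∉ φ.range, x * g ∈ φ.range := by
  rw [← MonoidHom.range_eq_top, or_iff_not_imp_left]
  intro htop
  obtain ⟨x, hx⟩ : ∃ x, x ∉ φ.range := by
    by_contra! hc
    exact htop (eq_top_iff.2 fun g _ ↦ hc g)
  -- Both y and φ(z)y lie outside the range, so both square to one; this forces y to invert φ(z).
  have hinv : ∀ y ∉ φ.range, y * y = 1 ∧ ∀ z, φ z * y = y * (φ z)⁻¹ := fun y hy ↦ by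
    have hyy : y * y = 1 := by rw [← sq]; exact h y hy
    refine ⟨hyy, fun z ↦ ?_⟩
    have hzy : φ z * y ∉ φ.range := fun hc ↦ hy ((mul_mem_cancel_left (MonoidHom.mem_range.2 ⟨z, rfl⟩)).1 hc)
    have := h _ hzy
    rw [sq, ← eq_inv_iff_mul_eq_one, mul_inv_rev, inv_eq_of_mul_eq_one_left hyy] at this
    exact this
  obtain ⟨hxx, hxφ⟩ := hinv x hx
  refine ⟨x, hx, hxx, hxφ, fun g hg ↦ ?_⟩
  -- If x, g and xg were all outside, conjugation by xg would invert φ(z) and, as a composite of two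
  -- inversions, also fix it; then φ(z)² = 1.
  by_contra hxg
  obtain ⟨z, hz⟩ := hN
  apply hz
  have h1 := (hinv _ hxg).2 z
  rw [← mul_assoc, hxφ, mul_assoc, mul_assoc, mul_left_cancel_iff, ← map_inv, (hinv g hg).2,
    mul_left_cancel_iff, map_inv, inv_inv, eq_inv_iff_mul_eq_one] at h1
  rw [sq, h1]

theorem nonempty_mulEquiv_cyc_or_dih (a : G) (ha : a ^ 2 ≠ 1) (h : ∀ g ∉ zpowers a, g ^ 2 = 1) :
    Nonempty (G ≃* Cyc (orderOf a)) ∨ Nonempty (G ≃* Dih (orderOf a)) := by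
  have hinj := cycLift_injective a rfl
  have hran := cycLift_range a (pow_orderOf_eq_one a)
  set φ := cycLift a (pow_orderOf_eq_one a)
  rw [← hran] at h
  have ha1 : φ (Multiplicative.ofAdd ((1 : ℤ) : ZMod _)) = a := by
    rw [cycLift_intCast, zpow_one]
  rcases surjective_or_exists_inverting φ ⟨_, by rwa [ha1]⟩ h with hs | ⟨x, hx, hxx, hxφ, hxg⟩
  · exact Or.inl ⟨(MulEquiv.ofBijective φ ⟨hinj, hs⟩).symm⟩
  · refine Or.inr ⟨(MulEquiv.ofBijective (dihLift φ x hxx hxφ) ⟨?_, fun g ↦ ?_⟩).symm⟩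
    · rw [injective_iff_map_eq_one]
      rintro (i | i) hi
      · rw [dihLift_r, map_eq_one_iff _ hinj] at hi
        exact congrArg DihedralGroup.r hi
      · rw [dihLift_sr] at hi
        exact absurd ⟨_, map_inv φ _ |>.trans (eq_inv_of_mul_eq_one_left hi).symm⟩ hx
    · by_cases hg : g ∈ φ.range
      · obtain ⟨z, rfl⟩ := hg
        exact ⟨.r z.toAdd, rfl⟩
      · obtain ⟨z, hz⟩ := hxg g hg
        refine ⟨.sr z.toAdd, ?_⟩
        rw [dihLift_sr, ofAdd_toAdd, hz, ← mul_assoc, hxx, one_mul]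

/-- The dichotomy is applied to the internal product ⟨c⟩ × ⟨a⟩. An outer element inverting it
commutes with c, since c is its own inverse, so ⟨c⟩ splits off and ⟨a⟩ extends to a dihedral factor.
-/
theorem nonempty_mulEquiv_cyc_two_prod (a c : G) (ha : orderOf a = 4) (hc : c ^ 2 = 1)
    (hca : Commute c a) (hc' : c ∉ zpowers a)
    (h : ∀ g, g ∉ zpowers a → c * g ∉ zpowers a → g ^ 2 = 1) :
    Nonempty (G ≃* Cyc 2 × Cyc 4) ∨ Nonempty (G ≃* Cyc 2 × Dih 4) := by
  have ha4 : a ^ 4 = 1 := orderOf_dvd_iff_pow_eq_one.1 ha.dvd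
  have hinj := cycLift_injective a ha
  have hran := cycLift_range a ha4
  have hc2 : orderOf c = 2 := orderOf_eq_prime hc (by rintro rfl; exact hc' (one_mem _))
  have hinjc := cycLift_injective c hc2
  have hranc := cycLift_range c hc
  have hφa : ∀ k : ℤ, cycLift a ha4 (Multiplicative.ofAdd (k : ZMod 4)) = a ^ k :=
    cycLift_intCast a ha4
  have hφc : ∀ k : ℤ, cycLift c hc (Multiplicative.ofAdd (k : ZMod 2)) = c ^ k :=
    cycLift_intCast c hc
  set φ := cycLift a ha4
  set ψ := cycLift c hc
  have hcomm : ∀ w z, Commute (ψ w) (φ z) := fun w z ↦ by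
    obtain ⟨k, rfl⟩ := exists_eq_intCast w
    obtain ⟨l, rfl⟩ := exists_eq_intCast z
    rw [hφa, hφc]
    exact (hca.zpow_left k).zpow_right l
  have hψ : ∀ w, ψ w ∈ φ.range → w = 1 := fun w hw ↦ by
    have hwc : ψ w ∈ zpowers c := hranc ▸ ⟨w, rfl⟩
    rcases eq_one_or_eq_of_mem_zpowers hc hwc with h1 | h1
    · exact (map_eq_one_iff _ hinjc).1 h1
    · rw [h1, hran] at hw
      exact absurd hw hc'
  set Φ := ψ.noncommCoprod φ hcomm
  have hΦ : ∀ w z, Φ (w, z) = ψ w * φ z := fun _ _ ↦ rfl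
  have hΦinj : Function.Injective Φ := by
    rw [injective_iff_map_eq_one]
    rintro ⟨w, z⟩ hwz
    rw [hΦ] at hwz
    have hw := hψ w ⟨z⁻¹, by rw [map_inv, eq_inv_of_mul_eq_one_left hwz]⟩
    rw [hw, map_one, one_mul, map_eq_one_iff _ hinj] at hwz
    rw [hw, hwz]; rfl
  have hφΦ : ∀ g ∈ zpowers a, g ∈ Φ.range := fun g hg ↦ by
    rw [← hran] at hg
    obtain ⟨z, rfl⟩ := hg
    exact ⟨(1, z), by rw [hΦ, map_one, one_mul]⟩
  have hcΦ : c ∈ Φ.range := ⟨(Multiplicative.ofAdd ((1 : ℤ) : ZMod 2), 1), by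
    rw [hΦ, hφc, map_one, mul_one, zpow_one]⟩
  have hΦh : ∀ g ∉ Φ.range, g ^ 2 = 1 := fun g hg ↦
    h g (fun hc ↦ hg (hφΦ g hc)) fun hc ↦ hg ((mul_mem_cancel_left hcΦ).1 (hφΦ _ hc))
  have hΦa : ∃ z, Φ z ^ 2 ≠ 1 := by
    refine ⟨(1, Multiplicative.ofAdd ((1 : ℤ) : ZMod 4)), ?_⟩
    rw [hΦ, hφa, map_one, one_mul, zpow_one]
    intro h2
    have := orderOf_dvd_iff_pow_eq_one.2 h2
    rw [ha] at this
    omega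
  rcases surjective_or_exists_inverting Φ hΦa hΦh with hs | ⟨x, hx, hxx, hxφ, hxg⟩
  · exact Or.inl ⟨(MulEquiv.ofBijective Φ ⟨hΦinj, hs⟩).symm⟩
  right
  have hxφ' : ∀ z, φ z * x = x * (φ z)⁻¹ := fun z ↦ by
    have := hxφ (1, z)
    rwa [hΦ, map_one, one_mul] at this
  have hxψ : ∀ w, Commute (ψ w) x := fun w ↦ by
    have hw := hxφ (w, 1)
    rw [hΦ, map_one, mul_one, ← map_inv] at hw
    have hinv : ∀ w : Cyc 2, w⁻¹ = w := by decide
    rwa [hinv] at hw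
  have hcomm' : ∀ w d, Commute (ψ w) (dihLift φ x hxx hxφ' d) := by
    rintro w (i | i)
    · exact hcomm w _
    · exact (hxψ w).mul_right (hcomm w _)
  refine ⟨(MulEquiv.ofBijective (ψ.noncommCoprod (dihLift φ x hxx hxφ') hcomm')
    ⟨?_, fun g ↦ ?_⟩).symm⟩
  · rw [injective_iff_map_eq_one]
    rintro ⟨w, i | i⟩ hi
    · rw [MonoidHom.noncommCoprod_apply, dihLift_r, ← hΦ, map_eq_one_iff _ hΦinj,
        Prod.mk_eq_one] at hi
      exact Prod.ext hi.1 (congrArg DihedralGroup.r hi.2)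
    · rw [MonoidHom.noncommCoprod_apply, dihLift_sr, ← mul_assoc, (hxψ w).eq, mul_assoc,
        ← hΦ] at hi
      exact absurd ⟨_, map_inv Φ _ |>.trans (eq_inv_of_mul_eq_one_left hi).symm⟩ hx
  · by_cases hg : g ∈ Φ.range
    · obtain ⟨⟨w, z⟩, rfl⟩ := hg
      exact ⟨(w, .r z.toAdd), rfl⟩
    · obtain ⟨⟨w, z⟩, hz⟩ := hxg g hg
      refine ⟨(w, .sr z.toAdd), ?_⟩
      rw [MonoidHom.noncommCoprod_apply, dihLift_sr, ofAdd_toAdd, ← mul_assoc, (hxψ w).eq,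
        mul_assoc, ← hΦ, hz, ← mul_assoc, hxx, one_mul]

/-- Exponent two forces commutativity, so `G` is a finite-dimensional space over `ZMod 2`; a basis
gives the coordinates. -/
theorem exists_mulEquiv_pi_cyc_two [Finite G] (h : ∀ g : G, g ^ 2 = 1) :
    ∃ n : ℕ, Nonempty (G ≃* (Fin n → Cyc 2)) := by
  let _ : CommGroup G :=
    { (inferInstance : Group G) with
      mul_comm := fun x y ↦ by
        have hinv : ∀ z : G, z⁻¹ = z := fun z ↦ inv_eq_of_mul_eq_one_left (by rw [← sq, h])
        rw [← hinv (x * y), mul_inv_rev, hinv, hinv] }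
  let _ : Module (ZMod 2) (Additive G) := AddCommGroup.zmodModule fun x ↦ h x.toMul
  have _ : Module.Finite (ZMod 2) (Additive G) := Module.Finite.of_finite
  let e := (Module.finBasis (ZMod 2) (Additive G)).equivFun
  exact ⟨_, ⟨{
    toFun := fun g i ↦ Multiplicative.ofAdd (e (Additive.ofMul g) i)
    invFun := fun v ↦ (e.symm fun i ↦ (v i).toAdd).toMul
    left_inv := fun g ↦ by simp
    right_inv := fun v ↦ by simp
    map_mul' := fun x y ↦ by ext i; simp }⟩⟩

end Inversion

/-! ### Large cyclic subgroups of the listed groups -/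

section Classification

variable {G : Type*} [Group G]

theorem MulEquiv.ncard_largeCyclic {H : Type*} [Group H] (e : G ≃* H) :
    (largeCyclic G).ncard = (largeCyclic H).ncard := by
  have himg : largeCyclic H = Subgroup.map e.toMonoidHom '' largeCyclic G := by
    ext K
    constructor
    · rintro ⟨g, hg, rfl⟩
      refine ⟨_, ⟨e.symm g, fun hc ↦ hg ?_, rfl⟩, ?_⟩
      · rwa [← map_pow, EmbeddingLike.map_eq_one_iff] at hc
      · rw [MonoidHom.map_zpowers]; simp
    · rintro ⟨_, ⟨g, hg, rfl⟩, rfl⟩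
      refine ⟨e g, fun hc ↦ hg ?_, ?_⟩
      · rwa [← map_pow, EmbeddingLike.map_eq_one_iff] at hc
      · rw [MonoidHom.map_zpowers]; rfl
  rw [himg, Set.ncard_image_of_injective _ (Subgroup.map_injective e.injective)]

theorem ncard_largeCyclic_cyc {n : ℕ} [NeZero n] :
    (largeCyclic (Cyc n)).ncard = (n.divisors.filter (2 < ·)).card := by
  have ho : orderOf (Multiplicative.ofAdd (1 : ZMod n)) = n := by
    rw [orderOf_ofAdd_eq_addOrderOf, ZMod.addOrderOf_one]
  rw [largeCyclic_ncard_of_forall_notMem (Multiplicative.ofAdd (1 : ZMod n)), ho]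
  intro g hg
  obtain ⟨k, rfl⟩ := exists_eq_intCast g
  exact absurd ⟨k, by simp [← ofAdd_zsmul]⟩ hg

theorem ncard_largeCyclic_dih {n : ℕ} [NeZero n] :
    (largeCyclic (Dih n)).ncard = (n.divisors.filter (2 < ·)).card := by
  rw [largeCyclic_ncard_of_forall_notMem (.r 1 : Dih n), DihedralGroup.orderOf_r_one]
  rintro (i | i) hi
  · obtain ⟨k, rfl⟩ := ZMod.intCast_surjective i
    exact absurd ⟨k, DihedralGroup.r_one_zpow k⟩ hi
  · rw [sq, DihedralGroup.sr_mul_self]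

theorem largeCyclic_eq_pair (a b : G) (ha : a ^ 2 ≠ 1) (hb : b ^ 2 ≠ 1)
    (h : ∀ g : G, g ^ 2 ≠ 1 → (g = a ∨ g = a⁻¹) ∨ g = b ∨ g = b⁻¹) :
    largeCyclic G = {zpowers a, zpowers b} := by
  ext H
  constructor
  · rintro ⟨g, hg, rfl⟩
    rcases h g hg with (rfl | rfl) | rfl | rfl <;> simp
  · rintro (rfl | rfl)
    · exact ⟨a, ha, rfl⟩
    · exact ⟨b, hb, rfl⟩

/-- The hypotheses avoid subgroups so that `decide` can check them in a concrete finite group; `hne`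
says that b is not a power of a. -/
theorem ncard_largeCyclic_eq_two (a b : G) (ha : a ^ 2 ≠ 1) (hb : b ^ 2 ≠ 1) (ha4 : a ^ 4 = 1)
    (hne : b ≠ 1 ∧ b ≠ a ∧ b ≠ a ^ 2 ∧ b ≠ a ^ 3)
    (h : ∀ g : G, g ^ 2 ≠ 1 → (g = a ∨ g = a⁻¹) ∨ g = b ∨ g = b⁻¹) :
    (largeCyclic G).ncard = 2 := by
  rw [largeCyclic_eq_pair a b ha hb h, Set.ncard_pair]
  intro hab
  have hb' : b ∈ zpowers a := hab ▸ mem_zpowers b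
  have hfin : IsOfFinOrder a := isOfFinOrder_iff_pow_eq_one.2 ⟨4, by norm_num, ha4⟩
  obtain ⟨k, rfl⟩ := hfin.mem_powers_iff_mem_zpowers.2 hb'
  simp only at hne
  rw [pow_eq_pow_mod k ha4] at hne
  have := Nat.mod_lt k (show 4 > 0 by norm_num)
  interval_cases k % 4 <;> simp at hne

theorem ncard_largeCyclic_cyc_two_prod_cyc_four : (largeCyclic (Cyc 2 × Cyc 4)).ncard = 2 :=
  ncard_largeCyclic_eq_two (1, Multiplicative.ofAdd 1)
    (Multiplicative.ofAdd 1, Multiplicative.ofAdd 1)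
    (by decide) (by decide) (by decide) (by decide) (by decide)

theorem ncard_largeCyclic_cyc_two_prod_dih_four : (largeCyclic (Cyc 2 × Dih 4)).ncard = 2 :=
  ncard_largeCyclic_eq_two (1, .r 1) (Multiplicative.ofAdd 1, .r 1)
    (by decide) (by decide) (by decide) (by decide) (by decide)

/-! ### Groups with zero, one or two large cyclic subgroups -/

variable [Finite G]

theorem ncard_largeCyclic_eq_zero_iff :
    (largeCyclic G).ncard = 0 ↔ ∃ n : ℕ, Nonempty (G ≃* (Fin n → Cyc 2)) := by
  rw [Set.ncard_eq_zero, largeCyclic, Set.image_eq_empty]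
  constructor
  · intro h
    refine exists_mulEquiv_pi_cyc_two fun g ↦ ?_
    by_contra hg
    exact (h ▸ hg : g ∈ (∅ : Set G))
  · rintro ⟨n, ⟨e⟩⟩
    refine Set.eq_empty_of_forall_notMem fun g hg ↦ hg (e.injective ?_)
    have hsq : ∀ z : Cyc 2, z ^ 2 = 1 := by decide
    rw [map_pow, map_one]
    exact funext fun i ↦ hsq _

/-- If all cyclic subgroups of order at least three lie in one of them, then `G` is cyclic or
dihedral. -/
theorem exists_mulEquiv_cyc_or_dih (a : G) (ha : a ^ 2 ≠ 1) (h : ∀ g ∉ zpowers a, g ^ 2 = 1) :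
    ∃ n : ℕ, (n.divisors.filter (2 < ·)).card = (largeCyclic G).ncard ∧
      (Nonempty (G ≃* Cyc n) ∨ Nonempty (G ≃* Dih n)) :=
  ⟨orderOf a, (largeCyclic_ncard_of_forall_notMem a h).symm,
    nonempty_mulEquiv_cyc_or_dih a ha h⟩

theorem ncard_largeCyclic_eq_one_iff :
    (largeCyclic G).ncard = 1 ↔
      Nonempty (G ≃* Cyc 4) ∨
      Nonempty (G ≃* Dih 4) ∨
      ∃ p : ℕ, p.Prime ∧ Odd p ∧ (Nonempty (G ≃* Cyc p) ∨ Nonempty (G ≃* Dih p)) := by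
  constructor
  · intro h
    obtain ⟨A, hA⟩ := Set.ncard_eq_one.1 h
    obtain ⟨a, ha, rfl⟩ : A ∈ largeCyclic G := by simp [hA]
    have hout : ∀ g ∉ zpowers a, g ^ 2 = 1 := fun g hg ↦ by
      by_contra hc
      have : zpowers g ∈ largeCyclic G := ⟨g, hc, rfl⟩
      rw [hA, Set.mem_singleton_iff] at this
      exact hg (this ▸ mem_zpowers g)
    obtain ⟨n, hn, hG⟩ := exists_mulEquiv_cyc_or_dih a ha hout
    rw [h, card_filter_two_lt_divisors_eq_one] at hn
    rcases hn with rfl | ⟨hp, hodd⟩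
    · rcases hG with hG | hG
      · exact Or.inl hG
      · exact Or.inr (Or.inl hG)
    · exact Or.inr (Or.inr ⟨n, hp, hodd, hG⟩)
  · have key : ∀ n : ℕ, n = 4 ∨ n.Prime ∧ Odd n → n ≠ 0 := by
      rintro n (rfl | ⟨hp, -⟩)
      · norm_num
      · exact hp.ne_zero
    have hcount : ∀ n : ℕ, n = 4 ∨ n.Prime ∧ Odd n →
        Nonempty (G ≃* Cyc n) ∨ Nonempty (G ≃* Dih n) → (largeCyclic G).ncard = 1 := by
      intro n hn hG
      have : NeZero n := ⟨key n hn⟩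
      rcases hG with ⟨⟨e⟩⟩ | ⟨⟨e⟩⟩
      · rw [e.ncard_largeCyclic, ncard_largeCyclic_cyc, card_filter_two_lt_divisors_eq_one.2 hn]
      · rw [e.ncard_largeCyclic, ncard_largeCyclic_dih, card_filter_two_lt_divisors_eq_one.2 hn]
    rintro (h | h | ⟨p, hp, hodd, h⟩)
    · exact hcount 4 (Or.inl rfl) (Or.inl h)
    · exact hcount 4 (Or.inl rfl) (Or.inr h)
    · exact hcount p (Or.inr ⟨hp, hodd⟩) h

/-- If `⟨a⟩` and `⟨b⟩` are incomparable and the only cyclic subgroups of order at least three, then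
they have order four, commute, and share their involution. -/
theorem sq_eq_sq_and_commute_of_incomparable {a b : G} (ha : a ^ 2 ≠ 1) (hb : b ^ 2 ≠ 1)
    (hab : a ∉ zpowers b) (hba : b ∉ zpowers a)
    (h : ∀ g : G, g ^ 2 ≠ 1 → zpowers g = zpowers a ∨ zpowers g = zpowers b) :
    a ^ 4 = 1 ∧ a ^ 2 = b ^ 2 ∧ Commute a b := by
  have conj_sq : ∀ x y : G, (x * y * x⁻¹) ^ 2 = x * y ^ 2 * x⁻¹ := fun x y ↦ conj_pow
  -- The conjugate of x by y generates ⟨x⟩ or ⟨y⟩; the latter would put x in ⟨y⟩.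
  have conj_mem : ∀ {x y : G}, x ^ 2 ≠ 1 → x ∉ zpowers y →
      (∀ g : G, g ^ 2 ≠ 1 → zpowers g = zpowers x ∨ zpowers g = zpowers y) →
      y * x * y⁻¹ ∈ zpowers x := fun {x y} hx hxy hxy' ↦ by
    have hc : (y * x * y⁻¹) ^ 2 ≠ 1 := by
      rw [conj_sq]
      intro hc
      exact hx (by simpa using hc)
    rcases hxy' _ hc with h1 | h1
    · exact h1 ▸ mem_zpowers _
    · have h2 : y * x * y⁻¹ ∈ zpowers y := h1 ▸ mem_zpowers _
      rw [mul_mem_cancel_right (inv_mem (mem_zpowers y)),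
        mul_mem_cancel_left (mem_zpowers y)] at h2
      exact absurd h2 hxy
  have hsq : (a * b) ^ 2 = 1 := by
    by_contra hc
    rcases h _ hc with h1 | h1
    · have h2 : a * b ∈ zpowers a := h1 ▸ mem_zpowers _
      exact hba ((mul_mem_cancel_left (mem_zpowers a)).1 h2)
    · have h2 : a * b ∈ zpowers b := h1 ▸ mem_zpowers _
      exact hab ((mul_mem_cancel_right (mem_zpowers b)).1 h2)
  -- Rewriting (ab)² = 1 this way expresses b² through a and a conjugate of a, both in ⟨a⟩.
  have hsq' : a * (b * a * b⁻¹) * b ^ 2 = 1 := by rw [← hsq, sq (a * b)]; group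
  have hb2 : b ^ 2 ∈ zpowers a := by
    have := conj_mem ha hab h
    rw [← inv_eq_of_mul_eq_one_right hsq']
    exact inv_mem (mul_mem (mem_zpowers a) this)
  have ha2 : a ^ 2 ∈ zpowers b := by
    have hconj : a * b * a⁻¹ ∈ zpowers b := conj_mem hb hba fun g hg ↦ (h g hg).symm
    have : b * (a * b * a⁻¹) * a ^ 2 = 1 := by
      have h3 : b * (a * b * a⁻¹) * a ^ 2 = a⁻¹ * (a * b) ^ 2 * a := by rw [sq (a * b)]; group
      rw [h3, hsq]; group
    rw [← inv_eq_of_mul_eq_one_right this]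
    exact inv_mem (mul_mem (mem_zpowers b) hconj)
  -- Since x² lies in both subgroups, ⟨x²⟩ can equal neither, so x² is not the generator of a large
  -- one.
  have h4 : ∀ {x y : G}, x ∉ zpowers y → y ∉ zpowers x → x ^ 2 ∈ zpowers y →
      (∀ g : G, g ^ 2 ≠ 1 → zpowers g = zpowers x ∨ zpowers g = zpowers y) → x ^ 4 = 1 :=
    fun {x y} hxy hyx hx2 hxy' ↦ by
      have hpow : x ^ 4 = (x ^ 2) ^ 2 := by group
      rw [hpow]
      by_contra hc
      rcases hxy' _ hc with h1 | h1
      · have h2 : x ∈ zpowers (x ^ 2) := h1 ▸ mem_zpowers x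
        exact hxy (zpowers_le.2 hx2 h2)
      · have h2 : y ∈ zpowers (x ^ 2) := h1 ▸ mem_zpowers y
        exact hyx (zpowers_le.2 (pow_mem (mem_zpowers x) 2) h2)
  have ha4 := h4 hab hba ha2 h
  have hb4 := h4 hba hab hb2 fun g hg ↦ (h g hg).symm
  have heq : a ^ 2 = b ^ 2 := by
    -- Write a² as a power of b with exponent modulo 4. Exponent 0 gives a² = 1, and an odd exponent
    -- gives b² = a⁴ = 1, so only 2 remains.
    obtain ⟨k, hk⟩ := mem_powers_iff_mem_zpowers.2 ha2
    simp only at hk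
    rw [pow_eq_pow_mod k hb4] at hk
    have hodd : b ^ 2 = a ^ 2 * a ^ 2 → False := fun hc ↦ by
      rw [← pow_add, ha4] at hc
      exact hb hc
    have := Nat.mod_lt k (show 4 > 0 by norm_num)
    interval_cases k % 4
    · exact absurd (by simpa using hk.symm) ha
    · exact (hodd (by rw [← hk]; group)).elim
    · exact hk.symm
    · exact (hodd (by
        rw [← hk, ← pow_add, show 3 + 3 = 4 + 2 from rfl, pow_add, hb4, one_mul])).elim
  refine ⟨ha4, heq, ?_⟩
  -- With b² = a², the relation for (ab)² makes this conjugate a⁻³, which is a because a⁴ = 1.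
  have hbab : b * a * b⁻¹ = a := by
    rw [← heq, mul_assoc, mul_eq_one_iff_inv_eq] at hsq'
    have h5 : b * a * b⁻¹ = a⁻¹ * (a ^ 2)⁻¹ := by rw [hsq']; group
    rw [h5, ← mul_inv_rev, inv_eq_iff_mul_eq_one, ← ha4]
    group
  exact (mul_inv_eq_iff_eq_mul.1 hbab).symm

theorem ncard_largeCyclic_eq_two_iff :
    (largeCyclic G).ncard = 2 ↔
      Nonempty (G ≃* Cyc 2 × Cyc 4) ∨
      Nonempty (G ≃* Cyc 2 × Dih 4) ∨
      Nonempty (G ≃* Cyc 8) ∨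
      Nonempty (G ≃* Dih 8) ∨
      ∃ p : ℕ, p.Prime ∧ Odd p ∧
        (Nonempty (G ≃* Cyc (p ^ 2)) ∨
         Nonempty (G ≃* Dih (p ^ 2)) ∨
         Nonempty (G ≃* Cyc (2 * p)) ∨
         Nonempty (G ≃* Dih (2 * p))) := by
  constructor
  · intro h
    obtain ⟨A, B, hAB, hpair⟩ := Set.ncard_eq_two.1 h
    obtain ⟨a, ha, rfl⟩ : A ∈ largeCyclic G := by simp [hpair]
    obtain ⟨b, hb, rfl⟩ : B ∈ largeCyclic G := by simp [hpair]
    have hlarge : ∀ g : G, g ^ 2 ≠ 1 → zpowers g = zpowers a ∨ zpowers g = zpowers b :=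
      fun g hg ↦ by
        have : zpowers g ∈ largeCyclic G := ⟨g, hg, rfl⟩
        rwa [hpair] at this
    have nested : ∀ c : G, c ^ 2 ≠ 1 → a ∈ zpowers c → b ∈ zpowers c → _ :=
      fun c hc hac hbc ↦ exists_mulEquiv_cyc_or_dih c hc fun g hg ↦ by
        by_contra hg2
        rcases hlarge g hg2 with h1 | h1
        · exact hg (zpowers_le.2 hac (h1 ▸ mem_zpowers g))
        · exact hg (zpowers_le.2 hbc (h1 ▸ mem_zpowers g))
    by_cases hcomp : a ∈ zpowers b ∨ b ∈ zpowers a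
    · obtain ⟨n, hn, hG⟩ : ∃ n : ℕ, (n.divisors.filter (2 < ·)).card = (largeCyclic G).ncard ∧
          (Nonempty (G ≃* Cyc n) ∨ Nonempty (G ≃* Dih n)) := by
        rcases hcomp with hc | hc
        · exact nested b hb hc (mem_zpowers b)
        · exact nested a ha (mem_zpowers a) hc
      rw [h, card_filter_two_lt_divisors_eq_two] at hn
      rcases hn with rfl | ⟨p, hp, hodd, rfl | rfl⟩
      · tauto
      · right; right; right; right
        exact ⟨p, hp, hodd, by tauto⟩
      · right; right; right; right
        exact ⟨p, hp, hodd, by tauto⟩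
    · push Not at hcomp
      obtain ⟨hab, hba⟩ := hcomp
      obtain ⟨ha4, hsq, hcomm⟩ := sq_eq_sq_and_commute_of_incomparable ha hb hab hba hlarge
      have ho : orderOf a = 4 := by
        have : Fact (Nat.Prime 2) := ⟨Nat.prime_two⟩
        exact orderOf_eq_prime_pow (p := 2) (n := 1) (by simpa using ha) (by simpa using ha4)
      have hprod : Nonempty (G ≃* Cyc 2 × Cyc 4) ∨ Nonempty (G ≃* Cyc 2 × Dih 4) := by
        refine nonempty_mulEquiv_cyc_two_prod a (a * b) ho ?_
          ((Commute.refl a).mul_left hcomm.symm) ?_ fun g hg hcg ↦ ?_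
        · rw [hcomm.mul_pow, ← hsq, ← pow_add, ha4]
        · rwa [mul_mem_cancel_left (mem_zpowers a)]
        · by_contra hg2
          rcases hlarge g hg2 with h1 | h1
          · exact hg (h1 ▸ mem_zpowers g)
          · have hgb : g ∈ zpowers b := h1 ▸ mem_zpowers g
            obtain ⟨k, rfl⟩ := mem_zpowers_iff.1 hgb
            obtain ⟨m, rfl | rfl⟩ := Int.even_or_odd' k
            · apply hg
              rw [zpow_mul, zpow_ofNat, ← hsq]
              exact zpow_mem (pow_mem (mem_zpowers a) 2) m
            · apply hcg
              -- Multiplying an odd power of b by ab leaves an even power of b, which is a power of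
              -- a² = b².
              have h2 : a * b * b ^ (2 * m + 1) = a * (b ^ 2) ^ (m + 1) := by group
              rw [h2, ← hsq]
              exact mul_mem (mem_zpowers a) (zpow_mem (pow_mem (mem_zpowers a) 2) _)
      tauto
  · have hcount : ∀ n : ℕ, (n.divisors.filter (2 < ·)).card = 2 →
        Nonempty (G ≃* Cyc n) ∨ Nonempty (G ≃* Dih n) → (largeCyclic G).ncard = 2 := by
      intro n hn hG
      have : NeZero n := ⟨by rintro rfl; simp at hn⟩
      rcases hG with ⟨⟨e⟩⟩ | ⟨⟨e⟩⟩
      · rw [e.ncard_largeCyclic, ncard_largeCyclic_cyc, hn]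
      · rw [e.ncard_largeCyclic, ncard_largeCyclic_dih, hn]
    have h8 := card_filter_two_lt_divisors_eq_two.2 (Or.inl (rfl : 8 = 8))
    rintro (⟨⟨e⟩⟩ | ⟨⟨e⟩⟩ | h | h | ⟨p, hp, hodd, h⟩)
    · rw [e.ncard_largeCyclic, ncard_largeCyclic_cyc_two_prod_cyc_four]
    · rw [e.ncard_largeCyclic, ncard_largeCyclic_cyc_two_prod_dih_four]
    · exact hcount 8 h8 (Or.inl h)
    · exact hcount 8 h8 (Or.inr h)
    · have hp2 := card_filter_two_lt_divisors_eq_two.2 (Or.inr ⟨p, hp, hodd, Or.inl rfl⟩)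
      have h2p := card_filter_two_lt_divisors_eq_two.2 (Or.inr ⟨p, hp, hodd, Or.inr rfl⟩)
      rcases h with h | h | h | h
      · exact hcount _ hp2 (Or.inl h)
      · exact hcount _ hp2 (Or.inr h)
      · exact hcount _ h2p (Or.inl h)
      · exact hcount _ h2p (Or.inr h)

end Classification

theorem theorem1p1 (G : Type*) [Group G] [Finite G] (r : ℤ)
    (hr : (numInvolutions G : ℤ) = (numCyclicSubgroups G : ℤ) - r) :
    (r = 0 ↔ ∃ n : ℕ, Nonempty (G ≃* (Fin n → Cyc 2))) ∧
    (r = 1 ↔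
      Nonempty (G ≃* Cyc 4) ∨
      Nonempty (G ≃* Dih 4) ∨
      ∃ p : ℕ, p.Prime ∧ Odd p ∧
        (Nonempty (G ≃* Cyc p) ∨
         Nonempty (G ≃* Dih p))) ∧
    (r = 2 ↔
      Nonempty (G ≃* Cyc 2 × Cyc 4) ∨
      Nonempty (G ≃* Cyc 2 × Dih 4) ∨
      Nonempty (G ≃* Cyc 8) ∨
      Nonempty (G ≃* Dih 8) ∨
      ∃ p : ℕ, p.Prime ∧ Odd p ∧
        (Nonempty (G ≃* Cyc (p ^ 2)) ∨
         Nonempty (G ≃* Dih (p ^ 2)) ∨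
         Nonempty (G ≃* Cyc (2 * p)) ∨
         Nonempty (G ≃* Dih (2 * p)))) := by
  have hr' : r = ((largeCyclic G).ncard : ℤ) := by
    rw [numCyclicSubgroups_eq] at hr
    push_cast at hr
    linarith
  rw [← ncard_largeCyclic_eq_zero_iff, ← ncard_largeCyclic_eq_one_iff,
    ← ncard_largeCyclic_eq_two_iff, hr']
  exact ⟨by norm_cast, by norm_cast, by norm_cast⟩
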